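/- Let $G$ and $H$ be locally compact (Hausdorff) abelian groups and let $(G\times H, L)$ be a cut and project scheme: $L$ is a discrete, cocompact subgroup of $G\times H$, the projection $\pi_1 : G\times H\to G$ is injective on $L$, and $\pi_2(L)$ is dense in $H$, where $\pi_2 : G\times H\to H$ is the projection. Write the elements of $L$ as pairs $(x,x^\star)$, where $x\in\pi_1(L)$ determines $x^\star\in H$. Let $h\in C_c(H)$ (continuous with compact support) be positive, i.e. $h(y)\ge 0$ for all $y\in H$, and positive definite, i.e. $\sum_{i,j=1}^n c_i\overline{c_j}\,h(y_i-y_j)\ge 0$ for all $n$, all $y_1,\dots,y_n\in H$ and all $c_1,\dots,c_n\in\mathbb C$. Then $$\omega_h=\sum_{(x,x^\star)\in L}h(x^\star)\,\delta_x$$ is a positive Radon measure on $G$ that belongs to $PPD(G)$, the set of positive Radon measures $\mu$ on $G$ with the following three properties. 1. $\mu$ is positive definite: $\mu(f*\widetilde f)\ge 0$ for every $f\in C_c(G)$, where $\widetilde f(x)=\overline{f(-x)}$ and the convolution is taken with respect to Haar measure. 2. $\mu$ is strong almost periodic: for every $f\in C_c(G)$ the function $(f*\mu)(x)=\int_G f(x-y)\,d\mu(y)$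 is bounded and uniformly continuous (that is, $\mu$ is translation bounded) and Bohr almost periodic (that is, it is continuous and for each $\varepsilon>0$ the set of $t\in G$ with $|(f*\mu)(y+t)-(f*\mu)(y)|\le\varepsilon$ for all $y\in G$ is relatively dense in $G$: its translates by the elements of some compact set cover $G$). 3. $\mu$ is discrete (pure point): for every compact $K\subseteq G$, the set of points of $K$ that are not atoms of $\mu$ is $\mu$-null. -/

import Mathlib

open MeasureTheory Topology
open scoped ComplexOrder ComplexConjugate CompactlySupported

/-- A complex function on an abelian group is positive definite if all the matrices
`(h (x i - x j))` are positive semidefinite. -/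
def IsPositiveDefiniteFun {H : Type*} [AddCommGroup H] (h : H → ℂ) : Prop :=
  ∀ (n : ℕ) (x : Fin n → H) (c : Fin n → ℂ),
    0 ≤ ∑ i, ∑ j, c i * conj (c j) * h (x i - x j)

/-- A cut and project scheme `(G × H, L)`: `L` is a lattice (a discrete cocompact subgroup)
in `G × H`, the projection to `G` is injective on `L`, and the projection of `L` to `H` is dense.
By injectivity the elements of `L` are the pairs `(x, x⋆)` with `x ∈ π₁ L`, where `⋆` is the
star map. -/
structure IsCutAndProjectScheme {G H : Type*} [AddCommGroup G] [TopologicalSpace G]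
    [AddCommGroup H] [TopologicalSpace H] (L : AddSubgroup (G × H)) : Prop where
  discrete : DiscreteTopology L
  cocompact : CompactSpace ((G × H) ⧸ L)
  injOn_fst : Set.InjOn Prod.fst (L : Set (G × H))
  dense_snd : Dense (Prod.snd '' (L : Set (G × H)))

/-- The weighted comb `∑_{(x, x⋆) ∈ L} h(x⋆) δ_x`, for a nonnegative weight function `h`. -/
noncomputable def weightedModelComb {G H : Type*} [AddCommGroup G] [MeasurableSpace G]
    [AddCommGroup H] (L : AddSubgroup (G × H)) (h : H → ℝ) : Measure G :=
  Measure.sum fun p : L => ENNReal.ofReal (h (p : G × H).2) • Measure.dirac (p : G × H).1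

/-- A discrete (pure point) measure: inside every compact set, the points that are not atoms
form a null set. -/
def IsDiscreteMeasure {G : Type*} [TopologicalSpace G] [MeasurableSpace G]
    (μ : Measure G) : Prop :=
  ∀ K : Set G, IsCompact K → μ (K \ {x | μ {x} ≠ 0}) = 0

section Measures

variable {G : Type*} [AddCommGroup G]

/-- `f~(x)` is the complex conjugate of `f(-x)`. -/
def tildeFun (f : G → ℂ) : G → ℂ := fun x => conj (f (-x))

/-- The convolution `(f * μ)(x) = ∫ f(x - y) dμ(y)` of a function and a measure. -/
noncomputable def convMeasure [MeasurableSpace G] (f : G → ℂ) (μ : Measure G) : G → ℂ :=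
  fun x => ∫ y, f (x - y) ∂μ

variable [TopologicalSpace G]

/-- Bohr almost periodicity: `F` is continuous and for each `ε > 0` its set of `ε`-almost periods
is relatively dense, i.e. some compact set translated by it covers the group. -/
def IsBohrAlmostPeriodic (F : G → ℂ) : Prop :=
  Continuous F ∧ ∀ ε : ℝ, 0 < ε → ∃ K : Set G, IsCompact K ∧
    ∀ x : G, ∃ t : G, (∀ y, ‖F (y + t) - F y‖ ≤ ε) ∧ x - t ∈ K

variable [IsTopologicalAddGroup G] [MeasurableSpace G]

/-- `f * μ` is bounded and uniformly continuous for all `f ∈ C_c(G)`. -/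
def IsTranslationBounded (μ : Measure G) : Prop :=
  ∀ f : C_c(G, ℂ),
    (letI : UniformSpace G := IsTopologicalAddGroup.rightUniformSpace G
     UniformContinuous (convMeasure f μ)) ∧
    ∃ C : ℝ, ∀ x, ‖convMeasure f μ x‖ ≤ C

/-- `μ` is translation bounded and `f * μ` is Bohr almost periodic for all `f ∈ C_c(G)`. -/
def IsStrongAlmostPeriodic (μ : Measure G) : Prop :=
  IsTranslationBounded μ ∧ ∀ f : C_c(G, ℂ), IsBohrAlmostPeriodic (convMeasure f μ)

/-- `μ(f * f~) ≥ 0` for all `f ∈ C_c(G)`, the convolution of functions being taken with respect to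
Haar measure. -/
def IsPositiveDefiniteMeasure [BorelSpace G] [LocallyCompactSpace G] (μ : Measure G) : Prop :=
  ∀ f : C_c(G, ℂ),
    0 ≤ ∫ x, convolution (f : G → ℂ) (tildeFun f) (ContinuousLinearMap.mul ℂ ℂ)
      Measure.addHaar x ∂μ

variable (G) in
/-- The positive, positive definite, strong almost periodic and discrete Radon measures on a locally
compact abelian group. Members of `Measure G` are positive; `Regular` says Radon, and includes
finiteness on compact sets. -/
def PPD [BorelSpace G] [LocallyCompactSpace G] : Set (Measure G) :=
  {μ | μ.Regular ∧ IsPositiveDefiniteMeasure μ ∧ IsStrongAlmostPeriodic μ ∧ IsDiscreteMeasure μ}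

end Measures

/-! The function `f * ω_h` is `x ↦ ∑ f(x - p₁) h(p₂)` over `p ∈ L`. As `L` is discrete and both
supports are compact, each such sum has at most `N` nonzero terms, with `N` independent of `x`.
Hence it is bounded by `N ‖f‖ ‖h‖`, and a small change of `f` or `h` in sup norm, within fixed
compact supports, changes it little, uniformly in `x`.

Moving `x` by a small `u` replaces `f` by a nearby translate: uniform continuity. Moving `x` by `q₁`
with `q ∈ L` amounts, after reindexing, to replacing `h` by `h(· + q₂)`: `q₁` is an almost period
once `q₂` is small, and such `q₁` are relatively dense by cocompactness of `L` and density of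
`π₂(L)`. Regularity and pure pointness hold because the atoms form a closed, locally finite set.

Positive definiteness needs no Fourier analysis. The function `b(p) = (f * f~)(p₁) h(p₂)` is
finitely supported and positive definite on the abstract group `L`, and `ω_h(f * f~) = ∑ b`.
Averaging `b(l - m)` over a Følner set exhibits `∑ b` as a limit of nonnegative numbers
(`sum_nonneg_of_posDef`). -/

/-! ### Discrete and cocompact subgroups -/

/-- Translates of a compact set contain boundedly many points of a discrete subgroup. -/
theorem AddSubgroup.exists_encard_translate_le {E : Type*} [AddCommGroup E] [TopologicalSpace E]
    [IsTopologicalAddGroup E] (Γ : AddSubgroup E) [DiscreteTopology Γ] {C : Set E}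
    (hC : IsCompact C) : ∃ N : ℕ, ∀ z : E, {p : Γ | (p : E) - z ∈ C}.encard ≤ N := by
  obtain ⟨U, hU, hUΓ⟩ : ∃ U ∈ 𝓝 (0 : E), ∀ p : Γ, (p : E) ∈ U → p = 0 := by
    have h0 : ({0} : Set Γ) ∈ 𝓝 (0 : Γ) := (isOpen_discrete _).mem_nhds rfl
    obtain ⟨U, hU, hsub⟩ := (mem_nhds_induced _ _ _).1 h0
    exact ⟨U, hU, fun p hp => hsub hp⟩
  obtain ⟨V, hV, hVU⟩ := exists_nhds_half_neg hU
  obtain ⟨T, -, hT⟩ := hC.elim_nhds_subcover (fun c => {y | y - c ∈ V}) fun c _ => by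
    have : Filter.Tendsto (fun y => y - c) (𝓝 c) (𝓝 0) := by
      simpa using (continuous_sub_right c).tendsto c
    exact this hV
  refine ⟨T.card, fun z => ?_⟩
  have key : ∀ p : Γ, (p : E) - z ∈ C → ∃ c ∈ T, (p : E) - z - c ∈ V := fun p hp => by
    simpa using hT hp
  choose! c hcT hcV using key
  rw [← Set.encard_coe_eq_coe_finsetCard]
  -- Two points sharing a centre `c` differ by an element of `V - V ⊆ U`, hence coincide.
  refine Set.encard_le_encard_of_injOn (f := c) (fun p hp => hcT p hp) fun p hp q hq hpq => ?_
  have := hVU _ (hcV p hp) _ (hcV q hq)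
  rw [hpq, sub_sub_sub_cancel_right, sub_sub_sub_cancel_right] at this
  exact sub_eq_zero.1 (hUΓ (p - q) this)

theorem AddSubgroup.finite_preimage_of_isCompact {E : Type*} [AddCommGroup E] [TopologicalSpace E]
    [IsTopologicalAddGroup E] (Γ : AddSubgroup E) [DiscreteTopology Γ] {C : Set E}
    (hC : IsCompact C) : {p : Γ | (p : E) ∈ C}.Finite := by
  obtain ⟨N, hN⟩ := Γ.exists_encard_translate_le hC
  simpa using Set.finite_of_encard_le_coe (hN 0)

/-- Sums over translates of a discrete subgroup of functions supported in a fixed compact set are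
uniformly controlled by the sup norm. -/
theorem AddSubgroup.exists_norm_tsum_translate_le {E : Type*} [AddCommGroup E]
    [TopologicalSpace E] [IsTopologicalAddGroup E] (Γ : AddSubgroup E) [DiscreteTopology Γ]
    {C : Set E} (hC : IsCompact C) : ∃ N : ℕ, ∀ (z : E) (Φ : E → ℂ) (A : ℝ),
      (∀ y, Φ y ≠ 0 → y ∈ C) → (∀ y, ‖Φ y‖ ≤ A) → ‖∑' p : Γ, Φ (p - z)‖ ≤ N * A := by
  obtain ⟨N, hN⟩ := Γ.exists_encard_translate_le hC
  refine ⟨N, fun z Φ A hΦ hA => ?_⟩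
  have hfin := Set.finite_of_encard_le_coe (hN z)
  have hcard : hfin.toFinset.card ≤ N := by
    have := hN z
    rw [hfin.encard_eq_coe_toFinset_card] at this
    exact_mod_cast this
  have hA0 : 0 ≤ A := (norm_nonneg _).trans (hA 0)
  rw [tsum_eq_sum (s := hfin.toFinset) fun p hp => by
    by_contra hne
    exact hp (by simpa using hΦ _ hne)]
  refine (norm_sum_le_of_le _ fun p _ => hA _).trans ?_
  rw [Finset.sum_const, nsmul_eq_mul]
  gcongr

/-- A cocompact subgroup of a locally compact group has a compact set of representatives. -/
theorem AddSubgroup.exists_isCompact_add_eq {E : Type*} [AddCommGroup E] [TopologicalSpace E]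
    [IsTopologicalAddGroup E] [LocallyCompactSpace E] (Γ : AddSubgroup E) [CompactSpace (E ⧸ Γ)] :
    ∃ C : Set E, IsCompact C ∧ ∀ z, ∃ p ∈ Γ, z - p ∈ C := by
  choose K hK hKn using fun z : E => exists_compact_mem_nhds z
  have hopen : IsOpenMap (QuotientAddGroup.mk : E → E ⧸ Γ) := QuotientAddGroup.isOpenMap_coe
  obtain ⟨T, -, hT⟩ := (isCompact_univ (X := E ⧸ Γ)).elim_nhds_subcover
    (fun q => QuotientAddGroup.mk '' K q.out) fun q _ => by
      have := hopen.image_mem_nhds (hKn q.out)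
      rwa [QuotientAddGroup.out_eq'] at this
  refine ⟨⋃ q ∈ T, K q.out, T.isCompact_biUnion fun q _ => hK _, fun z => ?_⟩
  obtain ⟨q, hq, y, hy, hyz⟩ := by simpa using hT (Set.mem_univ (z : E ⧸ Γ))
  refine ⟨-y + z, QuotientAddGroup.eq.1 hyz, ?_⟩
  simp only [Set.mem_iUnion]
  exact ⟨q, hq, by simpa using hy⟩

/-! ### Compactly supported functions -/

/-- Uniform continuity of compactly supported functions, in terms of translations. -/
theorem CompactlySupportedContinuousMap.eventually_norm_translate_sub_lt {E F : Type*}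
    [AddCommGroup E] [TopologicalSpace E] [IsTopologicalAddGroup E] [NormedAddCommGroup F]
    (f : C_c(E, F)) {ε : ℝ} (hε : 0 < ε) : ∀ᶠ u in 𝓝 (0 : E), ∀ x, ‖f (x + u) - f x‖ < ε := by
  let _ : UniformSpace E := IsTopologicalAddGroup.rightUniformSpace E
  have : IsUniformAddGroup E := isUniformAddGroup_of_addCommGroup
  have huc : UniformContinuous f := f.2.uniformContinuous_of_continuous f.1.2
  have := huc (Metric.dist_mem_uniformity hε)
  rw [Filter.mem_map, uniformity_eq_comap_nhds_zero, Filter.mem_comap] at this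
  obtain ⟨U, hU, hsub⟩ := this
  filter_upwards [hU] with u hu x
  have : ((x, x + u) : E × E) ∈ (fun p : E × E => p.2 - p.1) ⁻¹' U := by simpa using hu
  have := hsub this
  simpa [dist_eq_norm, norm_sub_rev] using this

theorem CompactlySupportedContinuousMap.exists_norm_le {E F : Type*} [TopologicalSpace E]
    [NormedAddCommGroup F] (f : C_c(E, F)) : ∃ A : ℝ, 0 ≤ A ∧ ∀ x, ‖f x‖ ≤ A := by
  obtain ⟨A, hA⟩ := f.2.exists_bound_of_continuous f.1.2
  exact ⟨max A 0, le_max_right _ _, fun x => (hA x).trans (le_max_left _ _)⟩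

/-! ### Følner sets and sums of positive definite functions -/

/-- Abelian groups satisfy the Følner condition. -/
theorem AddCommGroup.exists_foelner_pair {M : Type*} [AddCommGroup M] [DecidableEq M]
    (E : Finset M) {δ : ℝ} (hδ : 0 < δ) : ∃ F F' : Finset M, F.Nonempty ∧ F ⊆ F' ∧
      (∀ m ∈ F, ∀ e ∈ E, m + e ∈ F') ∧ (F'.card : ℝ) ≤ (1 + δ) * F.card := by
  -- Combinations of `E` with coefficients at most `n`: commutativity makes their number polynomial
  -- in `n`.
  let B : ℕ → Finset M := fun n =>
    (Fintype.piFinset fun _ : E => Finset.range (n + 1)).image fun v => ∑ e : E, v e • (e : M)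
  have hB0 : ∀ n, 0 ∈ B n := fun n => Finset.mem_image.2 ⟨0, by simp, by simp⟩
  have hmono : ∀ n, B n ⊆ B (n + 1) := fun n => Finset.image_subset_image fun v hv => by
    simp only [Fintype.mem_piFinset, Finset.mem_range] at hv ⊢
    exact fun e => (hv e).trans (by omega)
  have hadd : ∀ n, ∀ m ∈ B n, ∀ e ∈ E, m + e ∈ B (n + 1) := by
    intro n m hm e he
    obtain ⟨v, hv, rfl⟩ := Finset.mem_image.1 hm
    simp only [Fintype.mem_piFinset, Finset.mem_range] at hv
    refine Finset.mem_image.2 ⟨v + Pi.single ⟨e, he⟩ 1, ?_, ?_⟩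
    · simp only [Fintype.mem_piFinset, Finset.mem_range]
      intro a
      have := hv a
      have h1 : (Pi.single (⟨e, he⟩ : E) 1 : E → ℕ) a ≤ 1 := by
        rw [Pi.single_apply]; split_ifs <;> simp
      rw [Pi.add_apply]
      omega
    · simp [add_smul, Finset.sum_add_distrib, Pi.single_apply, ite_smul]
  have hcard : ∀ n, ((B n).card : ℝ) ≤ ((n + 1 : ℕ) : ℝ) ^ E.card := fun n => by
    have : (B n).card ≤ (n + 1) ^ E.card :=
      Finset.card_image_le.trans (by simp [Fintype.card_piFinset])
    exact_mod_cast this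
  -- If no pair `B n ⊆ B (n + 1)` works, `B n` grows exponentially, against the polynomial bound.
  by_contra! hcon
  have hgrow : ∀ n, (1 + δ) ^ n ≤ ((B n).card : ℝ) := by
    intro n
    induction n with
    | zero =>
      have : 0 < (B 0).card := Finset.card_pos.2 ⟨0, hB0 0⟩
      rw [pow_zero]
      exact_mod_cast this
    | succ n ih =>
      rw [pow_succ']
      exact (mul_le_mul_of_nonneg_left ih (by positivity)).trans
        (hcon (B n) (B (n + 1)) ⟨0, hB0 n⟩ (hmono n) (hadd n)).le
  have hlim := (tendsto_pow_const_div_const_pow_of_one_lt E.card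
    (show 1 < 1 + δ by linarith)).comp (Filter.tendsto_add_atTop_nat 1)
  obtain ⟨n, hn⟩ := (hlim.eventually_lt_const (show (0 : ℝ) < (1 + δ)⁻¹ by positivity)).exists
  simp only [Function.comp_apply] at hn
  have hpos : (0 : ℝ) < (1 + δ) ^ n := by positivity
  rw [pow_succ, div_lt_iff₀ (by positivity), mul_comm ((1 + δ) ^ n),
    inv_mul_cancel_left₀ (by positivity)] at hn
  exact absurd ((hgrow n).trans (hcard n)) (not_le.2 hn)

/-- The sum of a finitely supported positive definite function on an abelian group is
nonnegative. -/
theorem sum_nonneg_of_posDef {M : Type*} [AddCommGroup M] (b : M → ℂ) (E : Finset M)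
    (hE : ∀ m, b m ≠ 0 → m ∈ E) (hb : ∀ F : Finset M, 0 ≤ ∑ l ∈ F, ∑ m ∈ F, b (l - m)) :
    0 ≤ ∑ e ∈ E, b e := by
  classical
  have : OrderClosedTopology ℂ := Complex.orderClosedTopology
  refine (isClosed_Ici (a := (0 : ℂ))).closure_subset_iff.2 subset_rfl ?_
  rw [Metric.mem_closure_iff]
  intro ε hε
  set S : ℝ := ∑ e ∈ E, ‖b e‖
  have hS : 0 ≤ S := Finset.sum_nonneg fun _ _ => norm_nonneg _
  -- The `+ 1` covers `S = 0` and makes the final inequality strict.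
  obtain ⟨F, F', hF, hFF', hadd, hcard⟩ :=
    AddCommGroup.exists_foelner_pair E (δ := ε / (S + 1)) (by positivity)
  have hFpos : (0 : ℝ) < F.card := by exact_mod_cast Finset.card_pos.2 hF
  have hinner : ∀ m ∈ F, ∑ l ∈ F, b (l - m) = ∑ e ∈ E, if m + e ∈ F then b e else 0 := by
    intro m _
    rw [← Finset.sum_filter]
    refine Finset.sum_bij_ne_zero (fun l _ _ => l - m) ?_ ?_ ?_ ?_
    · intro l hl hne
      simpa [hl] using hE _ hne
    · intro l _ _ l' _ _ hll
      simpa using hll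
    · intro e he hne
      exact ⟨m + e, (Finset.mem_filter.1 he).2, by simpa using hne, by simp⟩
    · simp
  -- The defect at `e` counts the `m ∈ F` that `e` pushes out of `F`; translation by `e` injects
  -- them into `F' \ F`.
  have hdiff : (F.card : ℂ) * ∑ e ∈ E, b e - ∑ l ∈ F, ∑ m ∈ F, b (l - m) =
      ∑ e ∈ E, ((F.filter fun m => m + e ∉ F).card : ℂ) * b e := by
    rw [Finset.sum_comm, Finset.sum_congr rfl hinner, Finset.sum_comm, Finset.mul_sum,
      ← Finset.sum_sub_distrib]
    refine Finset.sum_congr rfl fun e _ => ?_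
    rw [← Finset.sum_filter, Finset.sum_const, nsmul_eq_mul, ← sub_mul,
      ← Finset.card_filter_add_card_filter_not (s := F) (fun m => m + e ∈ F)]
    push_cast
    ring
  have hcount : ∀ e ∈ E, ((F.filter fun m => m + e ∉ F).card : ℝ) ≤ ε / (S + 1) * F.card := by
    intro e he
    have h1 : (F.filter fun m => m + e ∉ F).card ≤ (F' \ F).card := by
      refine Finset.card_le_card_of_injOn (· + e) (fun m hm => ?_) (add_left_injective e).injOn
      have hm := Finset.mem_filter.1 hm
      exact Finset.mem_coe.2 (Finset.mem_sdiff.2 ⟨hadd m hm.1 e he, hm.2⟩)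
    have h2 := Finset.card_sdiff_add_card_eq_card hFF'
    have h3 : ((F' \ F).card : ℝ) + F.card = F'.card := by exact_mod_cast h2
    have h4 : ((F.filter fun m => m + e ∉ F).card : ℝ) ≤ (F' \ F).card := by exact_mod_cast h1
    linarith
  refine ⟨((F.card : ℝ)⁻¹ : ℝ) * ∑ l ∈ F, ∑ m ∈ F, b (l - m),
    mul_nonneg (by simp) (hb F), ?_⟩
  have heq : ∑ e ∈ E, b e - ((F.card : ℝ)⁻¹ : ℝ) * ∑ l ∈ F, ∑ m ∈ F, b (l - m) =
      ((F.card : ℝ)⁻¹ : ℝ) * ∑ e ∈ E, ((F.filter fun m => m + e ∉ F).card : ℂ) * b e := by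
    rw [← hdiff, mul_sub, ← mul_assoc]
    have : (F.card : ℂ) ≠ 0 := by exact_mod_cast hFpos.ne'
    simp [this]
  rw [dist_eq_norm, heq, norm_mul, Complex.norm_real, Real.norm_of_nonneg (by positivity)]
  have hsum : ‖∑ e ∈ E, ((F.filter fun m => m + e ∉ F).card : ℂ) * b e‖ ≤
      ε / (S + 1) * F.card * S := by
    rw [Finset.mul_sum]
    refine norm_sum_le_of_le _ fun e he => ?_
    rw [norm_mul, Complex.norm_natCast]
    exact mul_le_mul_of_nonneg_right (hcount e he) (norm_nonneg _)
  calc (F.card : ℝ)⁻¹ * ‖∑ e ∈ E, ((F.filter fun m => m + e ∉ F).card : ℂ) * b e‖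
      ≤ (F.card : ℝ)⁻¹ * (ε / (S + 1) * F.card * S) := by gcongr
    _ = ε * (S / (S + 1)) := by field_simp
    _ < ε := by
      refine mul_lt_of_lt_one_right hε ?_
      rw [div_lt_one (by positivity)]
      linarith

/-! ### The weighted comb: lattice sums, regularity, discreteness -/

theorem weightedModelComb_apply {G H : Type*} [AddCommGroup G] [MeasurableSpace G]
    [AddCommGroup H] (L : AddSubgroup (G × H)) (h : H → ℝ) {A : Set G} (hA : MeasurableSet A) :
    weightedModelComb L h A =
      ∑' p : L, ENNReal.ofReal (h (p : G × H).2) * A.indicator 1 (p : G × H).1 := by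
  rw [weightedModelComb, Measure.sum_apply _ hA]
  simp [hA]

theorem weightedModelComb_ne_zero {G H : Type*} [AddCommGroup G] [MeasurableSpace G]
    [MeasurableSingletonClass G] [AddCommGroup H] (L : AddSubgroup (G × H)) (h : H → ℝ) {p : L} (hp : 0 < h (p : G × H).2) :
    weightedModelComb L h {(p : G × H).1} ≠ 0 := by
  rw [weightedModelComb_apply L _ (measurableSet_singleton _)]
  intro h0
  have := ENNReal.tsum_eq_zero.1 h0 p
  simp [hp.not_ge] at this

section Comb

variable {G H : Type*} [AddCommGroup G] [TopologicalSpace G] [IsTopologicalAddGroup G]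
  [AddCommGroup H] [TopologicalSpace H] [IsTopologicalAddGroup H] (L : AddSubgroup (G × H))

theorem finite_lattice_inter_prod [DiscreteTopology L] {K : Set G} {S : Set H} (hK : IsCompact K)
    (hS : IsCompact S) : {p : L | (p : G × H).1 ∈ K ∧ (p : G × H).2 ∈ S}.Finite :=
  L.finite_preimage_of_isCompact (hK.prod hS)

theorem summable_lattice_mul [DiscreteTopology L] {K : Set G} {S : Set H} (hK : IsCompact K)
    (hS : IsCompact S) {φ : G → ℂ} {g : H → ℂ} (hφ : ∀ y, φ y ≠ 0 → y ∈ K)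
    (hg : ∀ y, g y ≠ 0 → y ∈ S) :
    Summable fun p : L => φ (p : G × H).1 * g (p : G × H).2 := by
  refine summable_of_hasFiniteSupport ((finite_lattice_inter_prod L hK hS).subset fun p hp => ?_)
  exact ⟨hφ _ (left_ne_zero_of_mul hp), hg _ (right_ne_zero_of_mul hp)⟩

theorem summable_lattice_sub_mul [DiscreteTopology L] {K : Set G} {S : Set H} (hK : IsCompact K)
    (hS : IsCompact S) {φ : G → ℂ} {g : H → ℂ} (hφ : ∀ y, φ y ≠ 0 → y ∈ K)
    (hg : ∀ y, g y ≠ 0 → y ∈ S) (x : G) :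
    Summable fun p : L => φ (x - (p : G × H).1) * g (p : G × H).2 :=
  summable_lattice_mul L (φ := fun y => φ (x - y)) (hK.image (continuous_sub_left x)) hS
    (fun y hy => ⟨x - y, hφ _ hy, sub_sub_cancel x y⟩) hg

/-- `N` depends only on `K` and `S`, so the bound also applies to differences of translates of `φ`
or `g`. -/
theorem exists_norm_tsum_lattice_le [DiscreteTopology L] {K : Set G} {S : Set H}
    (hK : IsCompact K) (hS : IsCompact S) : ∃ N : ℕ, ∀ (x : G) (φ : G → ℂ) (g : H → ℂ) (A B : ℝ),
      (∀ y, φ y ≠ 0 → y ∈ K) → (∀ y, g y ≠ 0 → y ∈ S) → (∀ y, ‖φ y‖ ≤ A) → (∀ y, ‖g y‖ ≤ B) →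
      ‖∑' p : L, φ (x - (p : G × H).1) * g (p : G × H).2‖ ≤ N * (A * B) := by
  obtain ⟨N, hN⟩ := L.exists_norm_tsum_translate_le ((hK.image continuous_neg).prod hS)
  refine ⟨N, fun x φ g A B hφ hg hA hB => ?_⟩
  have := hN (x, 0) (fun y => φ (-y.1) * g y.2) (A * B)
    (fun y hy => ⟨⟨-y.1, hφ _ (left_ne_zero_of_mul hy), neg_neg _⟩,
      hg _ (right_ne_zero_of_mul hy)⟩)
    (fun y => by
      rw [norm_mul]
      exact mul_le_mul (hA _) (hB _) (norm_nonneg _) ((norm_nonneg _).trans (hA 0)))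
  simpa using this

/-- Over a compact neighbourhood only finitely many lattice points have second coordinate in `S`, so
the image is locally finite. This serves both outer regularity and discreteness. -/
theorem isClosed_image_fst_lattice [T2Space G] [LocallyCompactSpace G] [DiscreteTopology L] {S : Set H}
    (hS : IsCompact S) {P : Set L} (hP : ∀ p ∈ P, (p : G × H).2 ∈ S) :
    IsClosed ((fun p : L => (p : G × H).1) '' P) := by
  have hlf : LocallyFinite fun p : P => ({((p : L) : G × H).1} : Set G) := by
    intro x
    obtain ⟨K, hK, hKx⟩ := exists_compact_mem_nhds x
    refine ⟨K, hKx, ?_⟩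
    refine ((finite_lattice_inter_prod L hK hS).preimage
      (Subtype.val_injective (p := (· ∈ P))).injOn).subset fun p hp => ?_
    exact ⟨by simpa using hp, hP p p.2⟩
  have := hlf.isClosed_iUnion fun _ => isClosed_singleton
  convert this
  ext x
  simp [eq_comm]

variable [T2Space G] [MeasurableSpace G] [BorelSpace G]

theorem weightedModelComb_restrict [DiscreteTopology L] (h : C_c(H, ℝ)) {K : Set G}
    (hK : IsCompact K) :
    (weightedModelComb L h).restrict K =
      ∑ p ∈ (finite_lattice_inter_prod L hK h.2).toFinset,
        ENNReal.ofReal (h (p : G × H).2) • Measure.dirac (p : G × H).1 := by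
  ext A hA
  rw [Measure.restrict_apply hA, weightedModelComb_apply L _ (hA.inter hK.measurableSet),
    tsum_eq_sum (s := (finite_lattice_inter_prod L hK h.2).toFinset), Measure.finsetSum_apply]
  · refine Finset.sum_congr rfl fun p hp => ?_
    have hp : (p : G × H).1 ∈ K := ((Set.Finite.mem_toFinset _).1 hp).1
    by_cases hpA : (p : G × H).1 ∈ A
    · simp [hA, hpA, Set.indicator_of_mem (show (p : G × H).1 ∈ A ∩ K from ⟨hpA, hp⟩)]
    · simp [hA, hpA]
  · intro p hp
    by_contra hne
    refine hp ((Set.Finite.mem_toFinset _).2 ⟨?_, ?_⟩)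
    · exact (Set.mem_of_indicator_ne_zero (right_ne_zero_of_mul hne)).2
    · refine subset_tsupport _ fun h0 : h (p : G × H).2 = 0 => hne ?_
      simp [h0]

theorem integral_weightedModelComb [DiscreteTopology L] (h : C_c(H, ℝ)) (h_nonneg : ∀ y, 0 ≤ h y)
    {K : Set G} (hK : IsCompact K) {g : G → ℂ} (hg : ∀ y, g y ≠ 0 → y ∈ K) :
    ∫ y, g y ∂weightedModelComb L h =
      ∑' p : L, g (p : G × H).1 * (h (p : G × H).2 : ℂ) := by
  rw [← setIntegral_eq_integral_of_forall_compl_eq_zero (s := K) fun y hy => by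
    by_contra hne
    exact hy (hg y hne)]
  rw [weightedModelComb_restrict L h hK, integral_finsetSum_measure,
    tsum_eq_sum (s := (finite_lattice_inter_prod L hK h.2).toFinset)]
  · refine Finset.sum_congr rfl fun p _ => ?_
    rw [integral_smul_measure, integral_dirac, ENNReal.toReal_ofReal (h_nonneg _)]
    simp [mul_comm]
  · intro p hp
    by_contra hne
    refine hp ((Set.Finite.mem_toFinset _).2 ⟨hg _ (left_ne_zero_of_mul hne), ?_⟩)
    exact subset_tsupport _ fun h0 : h (p : G × H).2 = 0 => hne (by simp [h0])
  · intro p _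
    exact (integrable_dirac (by simp)).smul_measure ENNReal.ofReal_ne_top

theorem convMeasure_weightedModelComb [DiscreteTopology L] (h : C_c(H, ℝ))
    (h_nonneg : ∀ y, 0 ≤ h y) (f : C_c(G, ℂ)) (x : G) :
    convMeasure f (weightedModelComb L h) x =
      ∑' p : L, f (x - (p : G × H).1) * (h (p : G × H).2 : ℂ) :=
  integral_weightedModelComb L h h_nonneg (g := fun y => f (x - y))
    (f.2.isCompact.image (continuous_sub_left x))
    fun y hy => ⟨x - y, subset_tsupport _ hy, sub_sub_cancel x y⟩

theorem weightedModelComb_regular [LocallyCompactSpace G] [DiscreteTopology L] (h : C_c(H, ℝ)) :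
    (weightedModelComb L h).Regular := by
  refine { lt_top_of_isCompact := ?_, outerRegular := ?_, innerRegular := ?_ }
  · intro K hK
    rw [← Measure.restrict_apply_self, weightedModelComb_restrict L h hK,
      Measure.finsetSum_apply]
    exact ENNReal.sum_lt_top.2 fun p _ => by
      rw [Measure.smul_apply, smul_eq_mul]
      exact ENNReal.mul_lt_top ENNReal.ofReal_lt_top (measure_lt_top _ _)
  · intro A hA r hr
    -- Removing all atoms outside `A` leaves an open set containing `A` with the same mass.
    set D := (fun p : L => (p : G × H).1) '' {p | h (p : G × H).2 ≠ 0 ∧ (p : G × H).1 ∉ A}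
    have hDc : IsClosed D :=
      isClosed_image_fst_lattice L h.2 fun p hp => subset_tsupport _ hp.1
    refine ⟨Dᶜ, ?_, hDc.isOpen_compl, lt_of_eq_of_lt ?_ hr⟩
    · rintro x hx ⟨p, hp, rfl⟩
      exact hp.2 hx
    · rw [weightedModelComb_apply L _ hDc.isOpen_compl.measurableSet,
        weightedModelComb_apply L _ hA]
      refine tsum_congr fun p => ?_
      by_cases h0 : h (p : G × H).2 = 0
      · simp [h0]
      · congr 1
        by_cases hpA : (p : G × H).1 ∈ A
        · have : (p : G × H).1 ∈ Dᶜ := by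
            rintro ⟨q, hq, hqp⟩
            exact hq.2 (by simpa only [hqp] using hpA)
          simp [hpA, this]
        · have : (p : G × H).1 ∉ Dᶜ := fun hc => hc ⟨p, ⟨h0, hpA⟩, rfl⟩
          simp [hpA, this]
  · intro U hU r hr
    -- A finite partial sum exceeding `r` is carried by a finite, hence compact, subset of `U`.
    rw [weightedModelComb_apply L _ hU.measurableSet, ENNReal.tsum_eq_iSup_sum, lt_iSup_iff] at hr
    obtain ⟨T, hT⟩ := hr
    set K := (fun p : L => (p : G × H).1) '' {p | p ∈ T ∧ (p : G × H).1 ∈ U}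
    have hK : K.Finite := (T.finite_toSet.subset fun p hp => hp.1).image _
    refine ⟨K, ?_, hK.isCompact, hT.trans_le ?_⟩
    · rintro _ ⟨p, hp, rfl⟩
      exact hp.2
    · rw [weightedModelComb_apply L _ hK.measurableSet]
      refine le_trans (Finset.sum_le_sum fun p hp => ?_) (ENNReal.sum_le_tsum T)
      refine mul_le_mul' le_rfl ?_
      by_cases hpU : (p : G × H).1 ∈ U
      · have : (p : G × H).1 ∈ K := ⟨p, ⟨hp, hpU⟩, rfl⟩
        simp [hpU, this]
      · simp [hpU]

theorem weightedModelComb_isDiscreteMeasure [LocallyCompactSpace G] [DiscreteTopology L]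
    (h : C_c(H, ℝ)) (h_nonneg : ∀ y, 0 ≤ h y) : IsDiscreteMeasure (weightedModelComb L h) := by
  intro K _
  set D := (fun p : L => (p : G × H).1) '' {p | h (p : G × H).2 ≠ 0}
  have hDc : IsClosed D :=
    isClosed_image_fst_lattice L h.2 fun p hp => subset_tsupport _ hp
  have hsub : K \ {x | weightedModelComb L h {x} ≠ 0} ⊆ Dᶜ := by
    rintro x ⟨-, hx⟩ ⟨p, hp, rfl⟩
    exact hx (weightedModelComb_ne_zero L h ((h_nonneg _).lt_of_ne' hp))
  refine measure_mono_null hsub ?_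
  rw [weightedModelComb_apply L _ hDc.isOpen_compl.measurableSet, ENNReal.tsum_eq_zero]
  intro p
  by_cases h0 : h (p : G × H).2 = 0
  · simp [h0]
  · have : (p : G × H).1 ∉ Dᶜ := fun hc => hc ⟨p, h0, rfl⟩
    simp [this]

end Comb

/-! ### Relative density of model sets -/

/-- Points of a cut and project set with a window that is a neighbourhood of zero are relatively
dense. -/
theorem IsCutAndProjectScheme.exists_isCompact_relativelyDense {G H : Type*}
    [AddCommGroup G] [TopologicalSpace G] [IsTopologicalAddGroup G] [LocallyCompactSpace G]
    [AddCommGroup H] [TopologicalSpace H] [IsTopologicalAddGroup H] [LocallyCompactSpace H]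
    {L : AddSubgroup (G × H)} (hL : IsCutAndProjectScheme L) {W : Set H} (hW : W ∈ 𝓝 (0 : H)) :
    ∃ K : Set G, IsCompact K ∧ ∀ x, ∃ q : L, (q : G × H).2 ∈ W ∧ x - (q : G × H).1 ∈ K := by
  have := hL.cocompact
  obtain ⟨C, hC, hCL⟩ := L.exists_isCompact_add_eq
  have hopen : ∀ p : L, IsOpen {z : H | z - (p : G × H).2 ∈ interior W} := fun p =>
    isOpen_interior.preimage (continuous_sub_right _)
  -- By density of `π₂(L)` the sets `p₂ + interior W` cover `H`; finitely many cover the compact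
  -- `π₂(C)`.
  obtain ⟨T, hT⟩ := (hC.image continuous_snd).elim_finite_subcover _ hopen fun y _ => by
    have hne : ((fun z : H => y - z) ⁻¹' interior W).Nonempty :=
      ⟨y, by simpa using mem_interior_iff_mem_nhds.2 hW⟩
    obtain ⟨_, hz, p, hp, rfl⟩ := hL.dense_snd.inter_open_nonempty _
      (isOpen_interior.preimage (continuous_sub_left y)) hne
    exact Set.mem_iUnion.2 ⟨⟨p, hp⟩, hz⟩
  refine ⟨⋃ p ∈ T, (fun c : G × H => (p : G × H).1 - c.1) '' C,
    T.isCompact_biUnion fun p _ => hC.image (by fun_prop), fun x => ?_⟩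
  -- With `(-x, 0) - l ∈ C` and `-l₂ - p₂ ∈ W`, the point `q = -l - p` has `q₂ ∈ W` and `x - q₁ = p₁
  -- - (-x - l₁)`.
  obtain ⟨l, hl, hlC⟩ := hCL (-x, 0)
  obtain ⟨p, hpT, hp⟩ := Set.mem_iUnion₂.1 (hT ⟨_, hlC, rfl⟩)
  refine ⟨-(⟨l, hl⟩ : L) - p, interior_subset (by simpa using hp), ?_⟩
  simp only [Set.mem_iUnion]
  refine ⟨p, hpT, _, hlC, ?_⟩
  simp
  abel

/-! ### Translation boundedness and almost periodicity -/

section AlmostPeriodic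

variable {G H : Type*} [AddCommGroup G] [TopologicalSpace G] [IsTopologicalAddGroup G]
  [T2Space G] [MeasurableSpace G] [BorelSpace G]
  [AddCommGroup H] [TopologicalSpace H] [IsTopologicalAddGroup H] (L : AddSubgroup (G × H))

theorem eventually_norm_convMeasure_translate_sub_le [LocallyCompactSpace G] [DiscreteTopology L] (h : C_c(H, ℝ))
    (h_nonneg : ∀ y, 0 ≤ h y) (f : C_c(G, ℂ)) {ε : ℝ} (hε : 0 < ε) :
    ∀ᶠ u in 𝓝 (0 : G), ∀ x, ‖convMeasure f (weightedModelComb L h) (x + u) -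
      convMeasure f (weightedModelComb L h) x‖ ≤ ε := by
  obtain ⟨B, hB0, hB⟩ := h.exists_norm_le
  obtain ⟨V, hV, hV0⟩ := exists_compact_mem_nhds (0 : G)
  -- One compact set contains the supports of all translates of `f` by `u ∈ V`, so `N` does not
  -- depend on `u`.
  have hK : IsCompact ((fun p : G × G => p.1 - p.2) '' (tsupport f ×ˢ V)) :=
    (f.2.isCompact.prod hV).image continuous_sub
  obtain ⟨N, hN⟩ := exists_norm_tsum_lattice_le L hK h.2.isCompact
  have hsupp : ∀ u ∈ V, ∀ y, f (y + u) ≠ 0 →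
      y ∈ (fun p : G × G => p.1 - p.2) '' (tsupport f ×ˢ V) := fun u hu y hy =>
    ⟨(y + u, u), ⟨subset_tsupport _ hy, hu⟩, add_sub_cancel_right _ _⟩
  have hsupp0 : ∀ y, f y ≠ 0 → y ∈ (fun p : G × G => p.1 - p.2) '' (tsupport f ×ˢ V) :=
    fun y hy => hsupp 0 (mem_of_mem_nhds hV0) y (by simpa using hy)
  have hh : ∀ y, (h y : ℂ) ≠ 0 → y ∈ tsupport h := fun y hy =>
    subset_tsupport _ fun h0 : h y = 0 => hy (by simp [h0])
  have hδ : 0 < ε / (N * B + 1) := by positivity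
  filter_upwards [hV0, f.eventually_norm_translate_sub_lt hδ] with u hu hfu x
  rw [convMeasure_weightedModelComb L h h_nonneg, convMeasure_weightedModelComb L h h_nonneg]
  have h1 := summable_lattice_sub_mul L hK h.2.isCompact (φ := fun y => f (y + u)) (hsupp u hu)
    hh x
  have h2 := summable_lattice_sub_mul L hK h.2.isCompact hsupp0 hh x
  simp only [add_sub_right_comm x u]
  rw [← h1.tsum_sub h2]
  simp only [← sub_mul]
  refine (hN x (fun y => f (y + u) - f y) (fun y => (h y : ℂ)) _ B (fun y hy => ?_) hh
    (fun y => (hfu y).le) fun y => by simpa using hB y).trans ?_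
  · by_cases h0 : f y = 0
    · exact hsupp u hu y (by simpa [h0] using hy)
    · exact hsupp0 y h0
  · rw [show (N : ℝ) * (ε / (N * B + 1) * B) = ε * (N * B / (N * B + 1)) by ring]
    refine mul_le_of_le_one_right hε.le ?_
    rw [div_le_one (by positivity)]
    linarith

theorem weightedModelComb_isTranslationBounded [LocallyCompactSpace G] [DiscreteTopology L] (h : C_c(H, ℝ))
    (h_nonneg : ∀ y, 0 ≤ h y) : IsTranslationBounded (weightedModelComb L h) := by
  intro f
  constructor
  · let _ : UniformSpace G := IsTopologicalAddGroup.rightUniformSpace G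
    have : IsUniformAddGroup G := isUniformAddGroup_of_addCommGroup
    change UniformContinuous _
    intro s hs
    obtain ⟨ε, hε, hs⟩ := Metric.mem_uniformity_dist.1 hs
    rw [Filter.mem_map, uniformity_eq_comap_nhds_zero, Filter.mem_comap]
    refine ⟨_, eventually_norm_convMeasure_translate_sub_le L h h_nonneg f (half_pos hε), ?_⟩
    rintro ⟨x, y⟩ hxy
    have := hxy x
    simp only [add_sub_cancel] at this
    refine hs ?_
    rw [dist_comm, dist_eq_norm]
    linarith
  · obtain ⟨N, hN⟩ := exists_norm_tsum_lattice_le L f.2.isCompact h.2.isCompact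
    obtain ⟨A, -, hA⟩ := f.exists_norm_le
    obtain ⟨B, -, hB⟩ := h.exists_norm_le
    refine ⟨N * (A * B), fun x => ?_⟩
    rw [convMeasure_weightedModelComb L h h_nonneg]
    exact hN x f (fun y => (h y : ℂ)) A B (fun y hy => subset_tsupport _ hy)
      (fun y hy => subset_tsupport _ fun h0 : h y = 0 => hy (by simp [h0])) hA
      fun y => by simpa using hB y

/-- If `q ∈ L` has small second coordinate then its first coordinate is an almost period. -/
theorem eventually_norm_convMeasure_lattice_translate_sub_le [LocallyCompactSpace H]
    [DiscreteTopology L] (h : C_c(H, ℝ)) (h_nonneg : ∀ y, 0 ≤ h y) (f : C_c(G, ℂ)) {ε : ℝ}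
    (hε : 0 < ε) :
    ∀ᶠ v in 𝓝 (0 : H), ∀ q : L, (q : G × H).2 = v →
      ∀ x, ‖convMeasure f (weightedModelComb L h) (x + (q : G × H).1) -
        convMeasure f (weightedModelComb L h) x‖ ≤ ε := by
  obtain ⟨A, hA0, hA⟩ := f.exists_norm_le
  obtain ⟨V, hV, hV0⟩ := exists_compact_mem_nhds (0 : H)
  have hS : IsCompact ((fun p : H × H => p.1 - p.2) '' (tsupport h ×ˢ V)) :=
    (h.2.isCompact.prod hV).image continuous_sub
  obtain ⟨N, hN⟩ := exists_norm_tsum_lattice_le L f.2.isCompact hS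
  have hsupp : ∀ u ∈ V, ∀ y, (h (y + u) : ℂ) ≠ 0 →
      y ∈ (fun p : H × H => p.1 - p.2) '' (tsupport h ×ˢ V) := fun u hu y hy =>
    ⟨(y + u, u), ⟨subset_tsupport _ fun h0 : h (y + u) = 0 => hy (by simp [h0]), hu⟩,
      add_sub_cancel_right _ _⟩
  have hsupp0 : ∀ y, (h y : ℂ) ≠ 0 →
      y ∈ (fun p : H × H => p.1 - p.2) '' (tsupport h ×ˢ V) :=
    fun y hy => hsupp 0 (mem_of_mem_nhds hV0) y (by simpa using hy)
  have hf : ∀ y, f y ≠ 0 → y ∈ tsupport f := fun y hy => subset_tsupport _ hy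
  have hδ : 0 < ε / (N * A + 1) := by positivity
  filter_upwards [hV0, h.eventually_norm_translate_sub_lt hδ] with v hv hhv q hq x
  -- Reindexing by `p ↦ p + q` cancels the shift in `f` and moves it to `h` as a shift by `v`.
  rw [convMeasure_weightedModelComb L h h_nonneg, convMeasure_weightedModelComb L h h_nonneg,
    ← (Equiv.addRight q).tsum_eq fun p : L =>
      f (x + (q : G × H).1 - (p : G × H).1) * (h (p : G × H).2 : ℂ)]
  simp only [Equiv.coe_addRight, AddSubgroup.coe_add, Prod.fst_add, Prod.snd_add, hq,
    add_sub_add_right_eq_sub]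
  have h1 := summable_lattice_sub_mul L f.2.isCompact hS (g := fun y => (h (y + v) : ℂ)) hf
    (hsupp v hv) x
  have h2 := summable_lattice_sub_mul L f.2.isCompact hS hf hsupp0 x
  rw [← h1.tsum_sub h2]
  simp only [← mul_sub]
  refine (hN x f (fun y => (h (y + v) : ℂ) - h y) A (ε / (N * A + 1)) hf (fun y hy => ?_) hA
    fun y => ?_).trans ?_
  · by_cases h0 : (h y : ℂ) = 0
    · exact hsupp v hv y (by simpa [h0] using hy)
    · exact hsupp0 y h0
  · rw [← Complex.ofReal_sub, Complex.norm_real]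
    exact (hhv y).le
  · rw [show (N : ℝ) * (A * (ε / (N * A + 1))) = ε * (N * A / (N * A + 1)) by ring]
    refine mul_le_of_le_one_right hε.le ?_
    rw [div_le_one (by positivity)]
    linarith

theorem IsCutAndProjectScheme.isStrongAlmostPeriodic [LocallyCompactSpace G]
    [LocallyCompactSpace H] {L : AddSubgroup (G × H)} (hL : IsCutAndProjectScheme L) (h : C_c(H, ℝ))
    (h_nonneg : ∀ y, 0 ≤ h y) : IsStrongAlmostPeriodic (weightedModelComb L h) := by
  have := hL.discrete
  have hTB := weightedModelComb_isTranslationBounded L h h_nonneg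
  refine ⟨hTB, fun f => ⟨?_, fun ε hε => ?_⟩⟩
  · let _ : UniformSpace G := IsTopologicalAddGroup.rightUniformSpace G
    exact (hTB f).1.continuous
  · obtain ⟨K, hK, hKx⟩ := hL.exists_isCompact_relativelyDense
      (eventually_norm_convMeasure_lattice_translate_sub_le L h h_nonneg f hε)
    refine ⟨K, hK, fun x => ?_⟩
    obtain ⟨q, hq, hqx⟩ := hKx x
    exact ⟨(q : G × H).1, hq q rfl, hqx⟩

end AlmostPeriodic

/-! ### Positive definiteness of the comb -/

theorem IsPositiveDefiniteFun.sum_nonneg {H ι : Type*} [AddCommGroup H] {h : H → ℂ}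
    (hh : IsPositiveDefiniteFun h) (F : Finset ι) (x : ι → H) (c : ι → ℂ) :
    0 ≤ ∑ l ∈ F, ∑ m ∈ F, c l * conj (c m) * h (x l - x m) := by
  have key := hh F.card (fun i => x (F.equivFin.symm i)) fun i => c (F.equivFin.symm i)
  have e : ∀ φ : ι → ℂ, ∑ i, φ (F.equivFin.symm i) = ∑ l ∈ F, φ l := fun φ => by
    rw [F.equivFin.symm.sum_comp fun l : F => φ l, Finset.sum_coe_sort]
  rw [e fun l => ∑ j, c l * conj (c (F.equivFin.symm j)) * h (x l - x (F.equivFin.symm j))] at key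
  rwa [Finset.sum_congr rfl fun l _ => e fun m => c l * conj (c m) * h (x l - x m)] at key

section PosDef

variable {G H : Type*} [AddCommGroup G] [TopologicalSpace G] [IsTopologicalAddGroup G]
  [LocallyCompactSpace G] [MeasurableSpace G] [BorelSpace G]

theorem convolution_tildeFun_apply (f : G → ℂ) (x : G) :
    convolution f (tildeFun f) (ContinuousLinearMap.mul ℂ ℂ) Measure.addHaar x =
      ∫ t, f t * conj (f (t - x)) ∂Measure.addHaar := by
  simp [convolution, tildeFun]

/-- Invariance of Haar measure under `t ↦ t + x` turns `f * f~` at a difference into an integral of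
rank-one kernels in `(x, y)`. -/
theorem convolution_tildeFun_sub (f : G → ℂ) (x y : G) :
    convolution f (tildeFun f) (ContinuousLinearMap.mul ℂ ℂ) Measure.addHaar (x - y) =
      ∫ t, f (t + x) * conj (f (t + y)) ∂Measure.addHaar := by
  rw [convolution_tildeFun_apply,
    ← integral_add_right_eq_self (fun t => f t * conj (f (t - (x - y)))) x]
  refine integral_congr_ae (.of_forall fun t => ?_)
  simp only [show t + x - (x - y) = t + y by abel]

theorem mem_sub_of_convolution_tildeFun_ne_zero (f : C_c(G, ℂ)) {x : G}
    (hx : convolution f (tildeFun f) (ContinuousLinearMap.mul ℂ ℂ) Measure.addHaar x ≠ 0) :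
    x ∈ (fun p : G × G => p.1 - p.2) '' (tsupport f ×ˢ tsupport f) := by
  rw [convolution_tildeFun_apply] at hx
  obtain ⟨t, ht⟩ : ∃ t, f t * conj (f (t - x)) ≠ 0 := by
    by_contra! h0
    simp [h0] at hx
  refine ⟨(t, t - x), ⟨subset_tsupport _ (left_ne_zero_of_mul ht), subset_tsupport _ ?_⟩,
    sub_sub_cancel t x⟩
  exact fun h0 : f (t - x) = 0 => ht (by simp [h0])

theorem integrable_translate_mul_conj_translate (f : C_c(G, ℂ)) (x y : G) :
    Integrable (fun t => f (t + x) * conj (f (t + y))) (Measure.addHaar : Measure G) := by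
  refine Continuous.integrable_of_hasCompactSupport ?_ ?_
  · have := f.continuous
    fun_prop
  · exact (f.2.comp_homeomorph (Homeomorph.addRight x)).mul_right

variable [T2Space G] [AddCommGroup H] [TopologicalSpace H] [IsTopologicalAddGroup H]

theorem weightedModelComb_isPositiveDefiniteMeasure (L : AddSubgroup (G × H))
    [DiscreteTopology L] (h : C_c(H, ℝ)) (h_nonneg : ∀ y, 0 ≤ h y)
    (h_posDef : IsPositiveDefiniteFun fun y => (h y : ℂ)) :
    IsPositiveDefiniteMeasure (weightedModelComb L h) := by
  intro f
  set a := convolution f (tildeFun f) (ContinuousLinearMap.mul ℂ ℂ) Measure.addHaar with ha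
  have hK : IsCompact ((fun p : G × G => p.1 - p.2) '' (tsupport f ×ˢ tsupport f)) :=
    (f.2.isCompact.prod f.2.isCompact).image continuous_sub
  have haK : ∀ y, a y ≠ 0 → y ∈ (fun p : G × G => p.1 - p.2) '' (tsupport f ×ˢ tsupport f) :=
    fun y hy => mem_sub_of_convolution_tildeFun_ne_zero f hy
  rw [integral_weightedModelComb L h h_nonneg hK haK]
  have hE : ∀ p : L, a (p : G × H).1 * (h (p : G × H).2 : ℂ) ≠ 0 →
      p ∈ (finite_lattice_inter_prod L hK h.2.isCompact).toFinset := fun p hp => by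
    refine (Set.Finite.mem_toFinset _).2 ⟨haK _ (left_ne_zero_of_mul hp), ?_⟩
    exact subset_tsupport _ fun h0 : h (p : G × H).2 = 0 => hp (by simp [h0])
  rw [tsum_eq_sum fun p hp => not_not.1 fun hne => hp (hE p hne)]
  refine sum_nonneg_of_posDef _ _ hE fun F => ?_
  have hint : ∀ l m : L, Integrable (fun t => f (t + (l : G × H).1) *
      conj (f (t + (m : G × H).1)) * (h ((l : G × H).2 - (m : G × H).2) : ℂ))
      (Measure.addHaar : Measure G) := fun l m =>
    (integrable_translate_mul_conj_translate f _ _).mul_const _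
  -- For fixed `t` the integrand is the quadratic form of `h` at the points `l₂` with coefficients
  -- `f(t + l₁)`, so it is nonnegative pointwise.
  have heq : ∑ l ∈ F, ∑ m ∈ F, a ((l - m : L) : G × H).1 * (h ((l - m : L) : G × H).2 : ℂ) =
      ∫ t, ∑ l ∈ F, ∑ m ∈ F, f (t + (l : G × H).1) * conj (f (t + (m : G × H).1)) *
        (h ((l : G × H).2 - (m : G × H).2) : ℂ) ∂Measure.addHaar := by
    rw [integral_finsetSum _ fun l _ => integrable_finsetSum _ fun m _ => hint l m]
    refine Finset.sum_congr rfl fun l _ => ?_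
    rw [integral_finsetSum _ fun m _ => hint l m]
    refine Finset.sum_congr rfl fun m _ => ?_
    rw [integral_mul_const, ← convolution_tildeFun_sub]
    rfl
  rw [heq]
  exact integral_nonneg fun t =>
    h_posDef.sum_nonneg F (fun l : L => (l : G × H).2) fun l => f (t + (l : G × H).1)

end PosDef

theorem lemma3p4 {G H : Type*}
    [AddCommGroup G] [TopologicalSpace G] [IsTopologicalAddGroup G] [LocallyCompactSpace G]
    [T2Space G] [MeasurableSpace G] [BorelSpace G]
    [AddCommGroup H] [TopologicalSpace H] [IsTopologicalAddGroup H] [LocallyCompactSpace H]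
    [T2Space H]
    (L : AddSubgroup (G × H)) (hL : IsCutAndProjectScheme L)
    (h : C_c(H, ℝ)) (h_nonneg : ∀ y, 0 ≤ h y)
    (h_posDef : IsPositiveDefiniteFun fun y => (h y : ℂ)) :
    weightedModelComb L h ∈ PPD G := by
  have := hL.discrete
  exact ⟨weightedModelComb_regular L h,
    weightedModelComb_isPositiveDefiniteMeasure L h h_nonneg h_posDef,
    hL.isStrongAlmostPeriodic h h_nonneg, weightedModelComb_isDiscreteMeasure L h h_nonneg⟩
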